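/- Let $S$ be a finite set of labeled points in the plane in general position, that is, with no three points of $S$ collinear. A crossing-free straight-edge graph on $S$ is a simple graph with vertex set $S$ such that, when every edge is drawn as the straight segment between its endpoints, no two distinct edges meet in a point of their relative interiors. Let $\mathrm{pg}(S)$ denote the number of crossing-free straight-edge graphs on $S$, and let $\mathrm{pg}(N)$ be the maximum of $\mathrm{pg}(S)$ over all sets $S$ of $N$ points in the plane in general position. Theorem. For every $N$, $\mathrm{pg}(N) \le 4096^N$. In other words, every set of $N$ points in the plane in general position admits at most $4096^N$ crossing-free straight-edge graphs. -/

import Mathlib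

/-- The Euclidean plane. -/
abbrev Plane : Type := EuclideanSpace ℝ (Fin 2)

/-- A finite point set in the plane is in general position if no three of its points are
collinear. -/
def GeneralPosition (S : Finset Plane) : Prop :=
  ∀ p ∈ S, ∀ q ∈ S, ∀ r ∈ S, p ≠ q → p ≠ r → q ≠ r → ¬ Collinear ℝ ({p, q, r} : Set Plane)

/-- A graph with vertex set `S`, its edges drawn as straight segments, is crossing-free if no two
distinct edges meet in a point of their relative interiors. (If `S` is in general position, this
says that distinct edges meet at most in a common endpoint, and that an edge contains no vertex
other than its two endpoints.) -/
def IsCrossingFree {S : Finset Plane} (G : SimpleGraph S) : Prop :=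
  ∀ a b c d : S, G.Adj a b → G.Adj c d → s(a, b) ≠ s(c, d) →
    Disjoint (openSegment ℝ (a : Plane) (b : Plane)) (openSegment ℝ (c : Plane) (d : Plane))

/-- The set of all crossing-free straight-edge graphs (plane graphs) on the labeled point set
`S`. -/
def planeGraphs (S : Finset Plane) : Set (SimpleGraph S) :=
  {G | IsCrossingFree G}

/-- The number of plane graphs on `S`. The set counted is finite, because `S` is. -/
noncomputable def pgCount (S : Finset Plane) : ℕ :=
  (planeGraphs S).ncard

/-- The maximum number of plane graphs on a set of `N` points in general position. It is formed in
`ℕ∞`, so that it has no default value: it bounds `pgCount S` for every such `S`. -/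
noncomputable def pgMax (N : ℕ) : ℕ∞ :=
  ⨆ (S : Finset Plane) (_ : S.card = N) (_ : GeneralPosition S), (pgCount S : ℕ∞)

/-!
Let `S` have `n` points, and consider pairs of a plane graph `G` on `S` and a point `p` of `S`. Let
`v` be the number of edges at `p`, whether present in `G` or not, that cross no edge of `G` minus
the edges at `p`. Since edges at `p` do not cross each other, the graphs that agree with `G` away
from `p` are obtained by choosing an arbitrary subset of these `v` edges. Such a class has `2 ^ v`
members, exactly one of which has `p` isolated, and `p` has average degree `v / 2` in it.

A plane graph has at most `3 n` edges, hence average degree at most `6`. So the average of `v` over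
all pairs is at most `12`, and by convexity the average of `2 ^ (-v)` is at least `2 ^ (-12)`. This
average is the proportion of the pairs in which `p` is isolated, and those correspond to the plane
graphs on `S` without `p`. Hence the number of plane graphs on `S` is at most `2 ^ 12 = 4096` times
the average over `p` of the number of plane graphs on `S` without `p`, and induction gives the
bound (`card_conflictFree_le`). The convexity step is used in the form
`13 * 2 ^ v ≤ 4096 + v * 2 ^ v`, summed over the classes (`thirteen_mul_card_fiber_le`).

The bound of `3 n` on the number of edges (`IsPlaneEdgeSet.card_le`) does not go through Euler's
formula. After a shear the points have distinct abscissas. Every edge is then the topmost edge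
arriving at its right endpoint, or the topmost edge leaving its left endpoint, or the first edge
vertically below some point, and each point accounts for at most one edge in each of these roles.
-/

/-! ### Counting conflict-free graphs -/

/-- The edge sets on `U` in which no two distinct edges are in conflict. Graphs are encoded by
their sets of (non-loop) edges, so that graphs on different vertex sets live in one type. -/
noncomputable def conflictFree {V : Type*} [DecidableEq V] (X : Sym2 V → Sym2 V → Prop)
    (U : Finset V) : Finset (Finset (Sym2 V)) := by
  classical
  exact U.sym2.powerset.filter fun A =>
    (∀ e ∈ A, ¬ e.IsDiag) ∧ ∀ e ∈ A, ∀ f ∈ A, e ≠ f → ¬ X e f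

lemma mem_conflictFree {V : Type*} [DecidableEq V] {X : Sym2 V → Sym2 V → Prop}
    {U : Finset V} {A : Finset (Sym2 V)} :
    A ∈ conflictFree X U ↔ (∀ e ∈ A, ∀ a ∈ e, a ∈ U) ∧ (∀ e ∈ A, ¬ e.IsDiag) ∧
      ∀ e ∈ A, ∀ f ∈ A, e ≠ f → ¬ X e f := by
  classical
  unfold conflictFree
  simp only [Finset.mem_filter, Finset.mem_powerset, Finset.subset_iff, Finset.mem_sym2_iff]

/-- The sizes of the subsets of a finite set average to half the size of the set. -/
lemma two_mul_sum_card_powerset {α : Type*} [DecidableEq α] (s : Finset α) :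
    2 * ∑ t ∈ s.powerset, t.card = s.card * 2 ^ s.card := by
  have h : ∑ t ∈ s.powerset, t.card = ∑ t ∈ s.powerset, (s \ t).card := by
    refine Finset.sum_nbij' (fun t => s \ t) (fun t => s \ t) ?_ ?_ ?_ ?_ ?_ <;>
      simp +contextual [Finset.sdiff_subset]
  have h2 : ∑ t ∈ s.powerset, t.card + ∑ t ∈ s.powerset, (s \ t).card
      = ∑ _t ∈ s.powerset, s.card := by
    rw [← Finset.sum_add_distrib]
    refine Finset.sum_congr rfl fun t ht => ?_
    rw [add_comm]
    exact Finset.card_sdiff_add_card_eq_card (Finset.mem_powerset.1 ht)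
  rw [Finset.sum_const, Finset.card_powerset, smul_eq_mul] at h2
  rw [mul_comm s.card]
  omega

/-- Convexity of `v ↦ 2 ^ (-v)` at `v = 12`, in integral form. -/
lemma thirteen_mul_two_pow_le (v : ℕ) : 13 * 2 ^ v ≤ 4096 + v * 2 ^ v := by
  rcases le_or_gt 13 v with h | h
  · exact (Nat.mul_le_mul_right _ h).trans (Nat.le_add_left _ _)
  · interval_cases v <;> norm_num

section Counting

variable {V : Type*} [DecidableEq V] {X : Sym2 V → Sym2 V → Prop}

/-- Deleting the edges at `p` from the graphs on `U` partitions them into classes, one for each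
graph `B` in which `p` is isolated. A class consists of the unions of `B` with the subsets of the
set of edges at `p` that are individually compatible with `B`, because edges at `p` are never in
conflict with each other. -/
lemma thirteen_mul_card_fiber_le (hsymm : ∀ e f, X e f → X f e)
    (hshare : ∀ p a b, p ≠ a → p ≠ b → a ≠ b → ¬ X s(p, a) s(p, b))
    {U : Finset V} {p : V} {B : Finset (Sym2 V)}
    (hB : B ∈ conflictFree X (U.erase p)) :
    ∑ A ∈ conflictFree X U with A.filter (p ∉ ·) = B, 13 ≤
      4096 + ∑ A ∈ conflictFree X U with A.filter (p ∉ ·) = B, 2 * (A.filter (p ∈ ·)).card := by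
  classical
  rw [mem_conflictFree] at hB
  obtain ⟨hBU, hBd, hBX⟩ := hB
  have hpB : ∀ e ∈ B, p ∉ e := fun e he hpe => by simpa using hBU e he p hpe
  -- the edges at `p` that are compatible with `B`
  set W : Finset (Sym2 V) :=
    U.sym2.filter fun e => ¬ e.IsDiag ∧ p ∈ e ∧ ∀ f ∈ B, ¬ X e f with hW
  have key : ∀ g : Finset (Sym2 V) → ℕ,
      ∑ A ∈ conflictFree X U with A.filter (p ∉ ·) = B, g (A.filter (p ∈ ·)) =
        ∑ s ∈ W.powerset, g s := by
    intro g
    refine Finset.sum_nbij' (fun A => A.filter (p ∈ ·)) (fun s => B ∪ s) ?_ ?_ ?_ ?_ ?_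
    · intro A hA
      simp only [Finset.mem_filter, mem_conflictFree] at hA
      obtain ⟨⟨hAU, hAd, hAX⟩, rfl⟩ := hA
      rw [Finset.mem_powerset]
      intro e he
      simp only [Finset.mem_filter] at he
      simp only [hW, Finset.mem_filter, Finset.mem_sym2_iff]
      refine ⟨hAU e he.1, hAd e he.1, he.2, fun f hf => hAX e he.1 f hf.1 ?_⟩
      rintro rfl
      exact hf.2 he.2
    · intro s hs
      rw [Finset.mem_powerset] at hs
      have hs' : ∀ e ∈ s, (∀ a ∈ e, a ∈ U) ∧ ¬ e.IsDiag ∧ p ∈ e ∧ ∀ f ∈ B, ¬ X e f := by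
        intro e he
        simpa only [hW, Finset.mem_filter, Finset.mem_sym2_iff] using hs he
      simp only [Finset.mem_filter, mem_conflictFree, Finset.mem_union]
      refine ⟨⟨?_, ?_, ?_⟩, ?_⟩
      · rintro e (he | he)
        · exact fun a ha => Finset.mem_of_mem_erase (hBU e he a ha)
        · exact (hs' e he).1
      · rintro e (he | he)
        · exact hBd e he
        · exact (hs' e he).2.1
      · rintro e (he | he) f (hf | hf) hne
        · exact hBX e he f hf hne
        · exact fun h => (hs' f hf).2.2.2 e he (hsymm _ _ h)
        · exact (hs' e he).2.2.2 f hf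
        · obtain ⟨-, hed, hpe, -⟩ := hs' e he
          obtain ⟨-, hfd, hpf, -⟩ := hs' f hf
          obtain ⟨a, rfl⟩ := hpe
          obtain ⟨b, rfl⟩ := hpf
          refine hshare p a b (by simpa using hed) (by simpa using hfd) ?_
          rintro rfl
          exact hne rfl
      · ext e
        simp only [Finset.mem_filter, Finset.mem_union]
        constructor
        · rintro ⟨he | he, hpe⟩
          · exact he
          · exact absurd (hs' e he).2.2.1 hpe
        · exact fun he => ⟨Or.inl he, hpB e he⟩
    · intro A hA
      simp only [Finset.mem_filter] at hA
      rw [← hA.2, Finset.union_comm]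
      exact Finset.filter_union_filter_not_eq _ _
    · intro s hs
      rw [Finset.mem_powerset] at hs
      ext e
      simp only [Finset.mem_filter, Finset.mem_union]
      constructor
      · rintro ⟨he | he, hpe⟩
        · exact absurd hpe (hpB e he)
        · exact he
      · intro he
        have := hs he
        simp only [hW, Finset.mem_filter] at this
        exact ⟨Or.inr he, this.2.2.1⟩
    · intro A _
      rfl
  rw [key fun _ => 13, key fun s => 2 * s.card, ← Finset.mul_sum, two_mul_sum_card_powerset,
    Finset.sum_const, Finset.card_powerset, smul_eq_mul, mul_comm]
  exact thirteen_mul_two_pow_le _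

/-- The inequality of `thirteen_mul_card_fiber_le`, summed over all graphs `B` on `U.erase p`. -/
lemma thirteen_mul_card_conflictFree_le (hsymm : ∀ e f, X e f → X f e)
    (hshare : ∀ p a b, p ≠ a → p ≠ b → a ≠ b → ¬ X s(p, a) s(p, b))
    (U : Finset V) (p : V) :
    13 * (conflictFree X U).card ≤ 4096 * (conflictFree X (U.erase p)).card +
      ∑ A ∈ conflictFree X U, 2 * (A.filter (p ∈ ·)).card := by
  classical
  have hmaps : ∀ A ∈ conflictFree X U, A.filter (p ∉ ·) ∈ conflictFree X (U.erase p) := by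
    intro A hA
    rw [mem_conflictFree] at hA ⊢
    simp only [Finset.mem_filter, Finset.mem_erase]
    refine ⟨fun e he a ha => ⟨?_, hA.1 e he.1 a ha⟩, fun e he => hA.2.1 e he.1,
      fun e he f hf => hA.2.2 e he.1 f hf.1⟩
    rintro rfl
    exact he.2 ha
  have h := Finset.sum_le_sum fun B (hB : B ∈ conflictFree X (U.erase p)) =>
    thirteen_mul_card_fiber_le hsymm hshare hB
  rw [Finset.sum_add_distrib, Finset.sum_fiberwise_of_maps_to hmaps,
    Finset.sum_fiberwise_of_maps_to hmaps, Finset.sum_const, Finset.sum_const, smul_eq_mul,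
    smul_eq_mul] at h
  linarith

/-- The handshake lemma for edge sets. -/
lemma sum_card_filter_mem_eq {U : Finset V} {A : Finset (Sym2 V)}
    (hU : ∀ e ∈ A, ∀ a ∈ e, a ∈ U) (hd : ∀ e ∈ A, ¬ e.IsDiag) :
    ∑ p ∈ U, (A.filter (p ∈ ·)).card = 2 * A.card := by
  classical
  refine (Finset.sum_card_bipartiteAbove_eq_sum_card_bipartiteBelow (fun p e => p ∈ e)).trans ?_
  rw [mul_comm]
  refine (Finset.sum_const_nat fun e he => ?_)
  have : U.bipartiteBelow (fun p e => p ∈ e) e = e.toFinset := by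
    ext a
    simp only [Finset.mem_bipartiteBelow, Sym2.mem_toFinset, and_iff_right_iff_imp]
    exact hU e he a
  rw [this, Sym2.card_toFinset_of_not_isDiag e (hd e he)]

/-- If edges sharing an endpoint are never in conflict, and conflict-free graphs have at most
three times as many edges as vertices, then there are at most `4096 ^ n` conflict-free graphs on
`n` vertices. -/
theorem card_conflictFree_le (hsymm : ∀ e f, X e f → X f e)
    (hshare : ∀ p a b, p ≠ a → p ≠ b → a ≠ b → ¬ X s(p, a) s(p, b))
    (hcard : ∀ U : Finset V, ∀ A ∈ conflictFree X U, A.card ≤ 3 * U.card) (U : Finset V) :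
    (conflictFree X U).card ≤ 4096 ^ U.card := by
  classical
  induction hn : U.card generalizing U with
  | zero =>
    obtain rfl := Finset.card_eq_zero.1 hn
    refine Finset.card_le_one.2 fun A hA B hB => ?_
    have aux : ∀ A ∈ conflictFree X (∅ : Finset V), A = ∅ := fun A hA => by
      simpa using hcard ∅ A hA
    rw [aux A hA, aux B hB]
  | succ n ih =>
    have h1 := Finset.sum_le_sum fun p (_ : p ∈ U) =>
      thirteen_mul_card_conflictFree_le hsymm hshare U p
    have h2 : ∑ p ∈ U, (conflictFree X (U.erase p)).card ≤ (n + 1) * 4096 ^ n := by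
      rw [← hn, ← smul_eq_mul]
      refine Finset.sum_le_card_nsmul _ _ _ fun p hp => ih _ ?_
      rw [Finset.card_erase_of_mem hp, hn, Nat.add_sub_cancel]
    have h3 : ∑ p ∈ U, ∑ A ∈ conflictFree X U, 2 * (A.filter (p ∈ ·)).card ≤
        12 * (n + 1) * (conflictFree X U).card := by
      rw [Finset.sum_comm, mul_comm, ← smul_eq_mul]
      refine Finset.sum_le_card_nsmul _ _ _ fun A hA => ?_
      have hA' := mem_conflictFree.1 hA
      rw [← Finset.mul_sum, sum_card_filter_mem_eq hA'.1 hA'.2.1]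
      have := hcard U A hA
      omega
    rw [Finset.sum_add_distrib, Finset.sum_const, ← Finset.mul_sum, hn, smul_eq_mul] at h1
    have h4 : (n + 1) * (conflictFree X U).card ≤ (n + 1) * 4096 ^ (n + 1) := by
      rw [pow_succ]
      nlinarith
    exact Nat.le_of_mul_le_mul_left h4 n.succ_pos

end Counting

/-! ### The number of edges of a plane graph -/

section EdgeBound

variable {V : Type*} (x y : V → ℝ)

/-- The height, at abscissa `t`, of the line through the points `e.1` and `e.2` with coordinate
functions `x` and `y`. -/
noncomputable def lineHeight (e : V × V) (t : ℝ) : ℝ :=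
  y e.1 + (y e.2 - y e.1) / (x e.2 - x e.1) * (t - x e.1)

variable {x y}

lemma lineHeight_left (e : V × V) : lineHeight x y e (x e.1) = y e.1 := by
  simp [lineHeight]

lemma lineHeight_right {e : V × V} (he : x e.1 < x e.2) : lineHeight x y e (x e.2) = y e.2 := by
  have : x e.2 - x e.1 ≠ 0 := by linarith
  simp [lineHeight, this]

/-- Two lines that change their vertical order between `s` and `t` meet strictly between. -/
lemma exists_lineHeight_eq {e f : V × V} {s t : ℝ} (hst : s < t)
    (hs : lineHeight x y e s < lineHeight x y f s)
    (ht : lineHeight x y f t < lineHeight x y e t) :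
    ∃ u, s < u ∧ u < t ∧ lineHeight x y e u = lineHeight x y f u := by
  have hc : ∀ e : V × V, Continuous (lineHeight x y e) := fun e => by
    unfold lineHeight; fun_prop
  obtain ⟨u, ⟨h1, h2⟩, h⟩ := intermediate_value_Ioo (f := fun u => lineHeight x y e u -
    lineHeight x y f u) hst.le ((hc e).sub (hc f)).continuousOn
    (show (0 : ℝ) ∈ _ from ⟨by linarith, by linarith⟩)
  exact ⟨u, h1, h2, by simpa [sub_eq_zero] using h⟩

/-- The order of two lines can be carried from `s` over to `t` when both lines meet at the third
abscissa `r` and `s`, `t` lie on the same side of it. -/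
lemma lineHeight_lt_of_eq {e f : V × V} {r s t : ℝ}
    (hr : lineHeight x y e r = lineHeight x y f r) (hside : 0 < (s - r) * (t - r))
    (hs : lineHeight x y e s < lineHeight x y f s) :
    lineHeight x y e t < lineHeight x y f t := by
  unfold lineHeight at *
  set m := (y e.2 - y e.1) / (x e.2 - x e.1)
  set n := (y f.2 - y f.1) / (x f.2 - x f.1)
  have h1 : 0 < (n - m) * (s - r) := by linarith
  have h2 : 0 < (n - m) * (t - r) := by
    have h3 : 0 < ((n - m) * (t - r)) * (s - r) ^ 2 := by
      have := mul_pos h1 hside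
      nlinarith
    exact pos_of_mul_pos_left h3 (sq_nonneg _)
  linarith

/-- The segment `e` is the first one that a vertical ray going down from the point `w` hits. -/
def IsFirstBelow (x y : V → ℝ) (E : Finset (V × V)) (w : V) (e : V × V) : Prop :=
  x e.1 < x w ∧ x w < x e.2 ∧ lineHeight x y e (x w) < y w ∧
    ∀ g ∈ E, x g.1 < x w → x w < x g.2 → lineHeight x y g (x w) < y w →
      lineHeight x y g (x w) ≤ lineHeight x y e (x w)

/-- A set of left-to-right directed segments between points of `U` with distinct abscissas, such
that no point lies on a segment of which it is not an endpoint, and no two segments cross. -/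
structure IsPlaneEdgeSet (x y : V → ℝ) (U : Finset V) (E : Finset (V × V)) : Prop where
  inj : Function.Injective x
  left_mem : ∀ e ∈ E, e.1 ∈ U
  right_mem : ∀ e ∈ E, e.2 ∈ U
  lt : ∀ e ∈ E, x e.1 < x e.2
  ne_height : ∀ e ∈ E, ∀ w, w ≠ e.1 → w ≠ e.2 → y w ≠ lineHeight x y e (x w)
  not_cross : ∀ e ∈ E, ∀ f ∈ E, e ≠ f → ∀ t, x e.1 < t → t < x e.2 → x f.1 < t → t < x f.2 →
    lineHeight x y e t ≠ lineHeight x y f t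

variable {U : Finset V} {E : Finset (V × V)}

namespace IsPlaneEdgeSet

/-- The vertical order of two non-crossing segments is the same at any two abscissas over which
both extend. -/
lemma le_of_lt (h : IsPlaneEdgeSet x y U E) {e f : V × V} (he : e ∈ E) (hf : f ∈ E) {s t : ℝ}
    (hes : x e.1 ≤ s) (hse : s ≤ x e.2) (hfs : x f.1 ≤ s) (hsf : s ≤ x f.2)
    (het : x e.1 ≤ t) (hte : t ≤ x e.2) (hft : x f.1 ≤ t) (htf : t ≤ x f.2)
    (hs : lineHeight x y e s < lineHeight x y f s) :
    lineHeight x y e t ≤ lineHeight x y f t := by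
  by_contra! ht
  have hne : e ≠ f := by rintro rfl; exact lt_irrefl _ hs
  rcases lt_trichotomy s t with hst | rfl | hst
  · obtain ⟨u, h1, h2, h3⟩ := exists_lineHeight_eq hst hs ht
    exact h.not_cross e he f hf hne u (by linarith) (by linarith) (by linarith) (by linarith) h3
  · exact lt_asymm hs ht
  · obtain ⟨u, h1, h2, h3⟩ := exists_lineHeight_eq hst ht hs
    exact h.not_cross e he f hf hne u (by linarith) (by linarith) (by linarith) (by linarith)
      h3.symm

lemma eq_of_isFirstBelow (h : IsPlaneEdgeSet x y U E) {e f : V × V} (he : e ∈ E) (hf : f ∈ E)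
    {w : V} (hwe : IsFirstBelow x y E w e) (hwf : IsFirstBelow x y E w f) : e = f := by
  by_contra hne
  exact h.not_cross e he f hf hne (x w) hwe.1 hwe.2.1 hwf.1 hwf.2.1 <|
    le_antisymm (hwf.2.2.2 e he hwe.1 hwe.2.1 hwe.2.2.1) (hwe.2.2.2 f hf hwf.1 hwf.2.1 hwf.2.2.1)

/-- An edge that is neither the topmost edge arriving at its right endpoint nor the topmost edge
leaving its left endpoint is the first edge below some point. With `f` the next edge above `e`
arriving at the right endpoint of `e`, the rightmost point of the wedge between `e` and `f` will
do: an edge separating it from `e` would be trapped in the wedge, and would have its right endpoint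
there.

Edges sharing an endpoint are compared by the heights of their lines at distance `1` from that
endpoint, which is a comparison of slopes; the edges need not extend that far. -/
lemma exists_isFirstBelow (h : IsPlaneEdgeSet x y U E) {e f' c : V × V}
    (he : e ∈ E) (hf' : f' ∈ E) (hc : c ∈ E) (hf'e : f'.2 = e.2) (hce : c.1 = e.1)
    (hf'lt : lineHeight x y e (x e.2 - 1) < lineHeight x y f' (x e.2 - 1))
    (hclt : lineHeight x y e (x e.1 + 1) < lineHeight x y c (x e.1 + 1)) :
    ∃ w ∈ U, IsFirstBelow x y E w e := by
  classical
  -- `f` is the lowest of the edges arriving at `e.2` above `e`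
  obtain ⟨f, hfm, hfmin⟩ := Finset.exists_min_image
    (E.filter fun f => f.2 = e.2 ∧ lineHeight x y e (x e.2 - 1) < lineHeight x y f (x e.2 - 1))
    (fun f => lineHeight x y f (x e.2 - 1)) ⟨f', by simp [hf', hf'e, hf'lt]⟩
  simp only [Finset.mem_filter] at hfm hfmin
  obtain ⟨hf, hfe, hflt⟩ := hfm
  have hel := h.lt e he
  have hfl := h.lt f hf
  have hcl := h.lt c hc
  have her : lineHeight x y e (x e.2) = y e.2 := lineHeight_right hel
  have hfr : lineHeight x y f (x e.2) = y e.2 := by rw [← hfe]; exact lineHeight_right hfl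
  have hcL : lineHeight x y c (x e.1) = y e.1 := by rw [← hce]; exact lineHeight_left c
  have hfgt : ∀ t, t < x e.2 → lineHeight x y e t < lineHeight x y f t := fun t ht =>
    lineHeight_lt_of_eq (her.trans hfr.symm) (by nlinarith) hflt
  have hcgt : ∀ t, x e.1 < t → lineHeight x y e t < lineHeight x y c t := fun t ht =>
    lineHeight_lt_of_eq ((lineHeight_left e).trans hcL.symm) (by nlinarith) hclt
  rw [hfe] at hfl
  rw [hce] at hcl
  -- the points in the wedge
  set W : Finset V := U.filter fun w => x e.1 < x w ∧ x w < x e.2 ∧ x f.1 ≤ x w ∧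
    lineHeight x y e (x w) < y w ∧ y w ≤ lineHeight x y f (x w) with hW
  have hWne : W.Nonempty := by
    rcases lt_or_ge (x e.1) (x f.1) with hfe1 | hfe1
    · refine ⟨f.1, ?_⟩
      simp only [hW, Finset.mem_filter, lineHeight_left]
      refine ⟨h.left_mem f hf, hfe1, hfl, le_rfl, ?_, le_rfl⟩
      rw [← lineHeight_left (x := x) (y := y) f]
      exact hfgt _ hfl
    · have hstart : lineHeight x y c (x e.1) < lineHeight x y f (x e.1) := by
        rw [hcL, ← lineHeight_left (x := x) (y := y) e]
        exact hfgt _ hel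
      have hc2 : x c.2 < x e.2 := by
        by_contra! hge
        have h1 := h.le_of_lt hc hf (s := x e.1) (t := x e.2) (by rw [hce]) hcl.le hfe1
          (by rw [hfe]; exact hel.le) (by rw [hce]; exact hel.le) hge hfl.le (by rw [hfe]) hstart
        have h2 := hcgt _ hel
        linarith
      have hcr : lineHeight x y c (x c.2) = y c.2 := lineHeight_right (h.lt c hc)
      refine ⟨c.2, ?_⟩
      simp only [hW, Finset.mem_filter]
      refine ⟨h.right_mem c hc, hcl, hc2, by linarith, ?_, ?_⟩
      · rw [← hcr]; exact hcgt _ hcl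
      · rw [← hcr]
        exact h.le_of_lt hc hf (s := x e.1) (t := x c.2) (by rw [hce]) hcl.le hfe1
          (by rw [hfe]; exact hel.le) (h.lt c hc).le le_rfl (by linarith)
          (by rw [hfe]; exact hc2.le) hstart
  obtain ⟨w, hwW, hwmax⟩ := Finset.exists_max_image W x hWne
  simp only [hW, Finset.mem_filter] at hwW hwmax
  obtain ⟨hwU, hw1, hw2, hwf, hwe, hwle⟩ := hwW
  refine ⟨w, hwU, hw1, hw2, hwe, fun g hg hgl hgr hgw => ?_⟩
  by_contra! hge
  have hgf : lineHeight x y g (x w) < lineHeight x y f (x w) := by linarith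
  have hg2 : lineHeight x y g (x g.2) = y g.2 := lineHeight_right (h.lt g hg)
  rcases lt_trichotomy (x g.2) (x e.2) with hlt | heq | hgt
  · -- the right endpoint of `g` is a point of the wedge to the right of `w`
    have h1 := h.le_of_lt he hg hw1.le hw2.le hgl.le hgr.le (t := x g.2) (by linarith) hlt.le
      (by linarith) le_rfl hge
    have h2 := h.le_of_lt hg hf hgl.le hgr.le hwf (by rw [hfe]; exact hw2.le) (t := x g.2)
      (by linarith) le_rfl (by linarith) (by rw [hfe]; exact hlt.le) hgf
    rw [hg2] at h1 h2
    have h3 : y g.2 ≠ lineHeight x y e (x g.2) := by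
      refine h.ne_height e he g.2 ?_ ?_ <;> intro h4 <;> rw [h4] at hlt hgr <;> linarith
    have := hwmax g.2 ⟨h.right_mem g hg, by linarith, hlt, by linarith, lt_of_le_of_ne h1 h3.symm,
      h2⟩
    linarith
  · -- `g` arrives at `e.2` between `e` and `f`
    have hge2 : g.2 = e.2 := h.inj heq
    have hgr' : lineHeight x y g (x e.2) = y e.2 := by rw [← hge2]; exact hg2
    have h1 : lineHeight x y e (x e.2 - 1) < lineHeight x y g (x e.2 - 1) :=
      lineHeight_lt_of_eq (her.trans hgr'.symm) (by nlinarith) hge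
    have h2 : lineHeight x y g (x e.2 - 1) < lineHeight x y f (x e.2 - 1) :=
      lineHeight_lt_of_eq (hgr'.trans hfr.symm) (by nlinarith) hgf
    have := hfmin g ⟨hg, hge2, h1⟩
    linarith
  · -- `g` passes through `e.2`
    have h1 := h.le_of_lt he hg hw1.le hw2.le hgl.le hgr.le (t := x e.2) (by linarith) le_rfl
      (by linarith) hgt.le hge
    have h2 := h.le_of_lt hg hf hgl.le hgr.le hwf (by rw [hfe]; exact hw2.le) (t := x e.2)
      (by linarith) hgt.le (by linarith) (by rw [hfe]) hgf
    rw [her] at h1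
    rw [hfr] at h2
    refine h.ne_height g hg e.2 ?_ ?_ (le_antisymm h1 h2) <;> intro h4 <;> rw [h4] at hw2 hgt <;>
      linarith

/-- A substitute for Euler's formula: every edge is the topmost edge arriving at its right
endpoint, the topmost edge leaving its left endpoint, or the first edge below some point, and every
point is used at most once in each of the three roles. -/
theorem card_le (h : IsPlaneEdgeSet x y U E) : E.card ≤ 3 * U.card := by
  classical
  set M₁ := E.filter fun e => ∀ f ∈ E, f.2 = e.2 →
    lineHeight x y f (x e.2 - 1) ≤ lineHeight x y e (x e.2 - 1)
  set M₂ := E.filter fun e => ∀ f ∈ E, f.1 = e.1 →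
    lineHeight x y f (x e.1 + 1) ≤ lineHeight x y e (x e.1 + 1)
  set M₃ := E.filter fun e => ∃ w ∈ U, IsFirstBelow x y E w e
  have hcover : E ⊆ M₁ ∪ M₂ ∪ M₃ := by
    intro e he
    by_contra hn
    simp only [M₁, M₂, M₃, Finset.mem_union, Finset.mem_filter, he, true_and, not_or,
      not_forall, not_le] at hn
    obtain ⟨⟨⟨f, hf, hfe, hflt⟩, c, hc, hce, hclt⟩, hn⟩ := hn
    exact hn (h.exists_isFirstBelow he hf hc hfe hce hflt hclt)
  -- distinct edges that share an endpoint have different slopes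
  have h₁ : M₁.card ≤ U.card := by
    refine Finset.card_le_card_of_injOn Prod.snd
      (fun e he => h.right_mem e (Finset.mem_filter.1 he).1) fun e he f hf hef => ?_
    simp only [M₁, Finset.coe_filter, Set.mem_ofPred_eq] at he hf
    by_contra hne
    have heq := le_antisymm (hf.2 e he.1 hef) (by rw [← hef]; exact he.2 f hf.1 hef.symm)
    have hel := h.lt e he.1
    have hfl := h.lt f hf.1
    have her : lineHeight x y e (x f.2) = y f.2 := by rw [← hef]; exact lineHeight_right hel
    have hfr : lineHeight x y f (x f.2) = y f.2 := lineHeight_right hfl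
    rw [hef] at hel
    obtain ⟨t, ht, htf⟩ := exists_between (max_lt hel hfl)
    rw [max_lt_iff] at ht
    refine h.not_cross e he.1 f hf.1 hne t ht.1 (by rw [hef]; exact htf) ht.2 htf ?_
    unfold lineHeight at *
    linear_combination (x f.2 - t) * heq + (1 - (x f.2 - t)) * (her - hfr)
  have h₂ : M₂.card ≤ U.card := by
    refine Finset.card_le_card_of_injOn Prod.fst
      (fun e he => h.left_mem e (Finset.mem_filter.1 he).1) fun e he f hf hef => ?_
    simp only [M₂, Finset.coe_filter, Set.mem_ofPred_eq] at he hf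
    by_contra hne
    have heq := le_antisymm (hf.2 e he.1 hef) (by rw [← hef]; exact he.2 f hf.1 hef.symm)
    have hel := h.lt e he.1
    have hfl := h.lt f hf.1
    have her : lineHeight x y e (x f.1) = y f.1 := by rw [← hef]; exact lineHeight_left e
    have hfr : lineHeight x y f (x f.1) = y f.1 := lineHeight_left f
    rw [hef] at hel
    obtain ⟨t, htf, ht⟩ := exists_between (lt_min hel hfl)
    rw [lt_min_iff] at ht
    refine h.not_cross e he.1 f hf.1 hne t (by rw [hef]; exact htf) ht.1 htf ht.2 ?_
    unfold lineHeight at *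
    linear_combination (t - x f.1) * heq + (1 - (t - x f.1)) * (her - hfr)
  have h₃ : M₃.card ≤ U.card := by
    have hM : ∀ e, ∃ w, e ∈ M₃ → w ∈ U ∧ IsFirstBelow x y E w e := fun e => by
      by_cases he : e ∈ M₃
      · obtain ⟨w, hw⟩ := (Finset.mem_filter.1 he).2
        exact ⟨w, fun _ => hw⟩
      · exact ⟨e.1, fun h => absurd h he⟩
    choose φ hφ using hM
    exact Finset.card_le_card_of_injOn φ (fun e he => (hφ e he).1) fun e he f hf hef =>
      h.eq_of_isFirstBelow (Finset.mem_filter.1 he).1 (Finset.mem_filter.1 hf).1 (hφ e he).2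
        (by rw [hef]; exact (hφ f hf).2)
  calc E.card ≤ (M₁ ∪ M₂ ∪ M₃).card := Finset.card_le_card hcover
    _ ≤ M₁.card + M₂.card + M₃.card :=
      (Finset.card_union_le _ _).trans (Nat.add_le_add_right (Finset.card_union_le _ _) _)
    _ ≤ 3 * U.card := by omega

end IsPlaneEdgeSet

end EdgeBound

/-! ### Point sets in general position -/

section PointSets

/-- The segments drawn for two edges meet in a point of their relative interiors. -/
def SegmentsMeet {S : Finset Plane} (e f : Sym2 S) : Prop :=
  ∃ a b c d : S, e = s(a, b) ∧ f = s(c, d) ∧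
    ¬ Disjoint (openSegment ℝ (a : Plane) (b : Plane)) (openSegment ℝ (c : Plane) (d : Plane))

lemma SegmentsMeet.symm {S : Finset Plane} {e f : Sym2 S} (h : SegmentsMeet e f) :
    SegmentsMeet f e := by
  obtain ⟨a, b, c, d, he, hf, h⟩ := h
  exact ⟨c, d, a, b, hf, he, fun h' => h h'.symm⟩

lemma segmentsMeet_mk {S : Finset Plane} {a b c d : S} :
    SegmentsMeet s(a, b) s(c, d) ↔ ¬ Disjoint (openSegment ℝ (a : Plane) (b : Plane))
      (openSegment ℝ (c : Plane) (d : Plane)) := by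
  constructor
  · rintro ⟨a', b', c', d', hab, hcd, h⟩
    rcases Sym2.eq_iff.1 hab with ⟨rfl, rfl⟩ | ⟨rfl, rfl⟩ <;>
    rcases Sym2.eq_iff.1 hcd with ⟨rfl, rfl⟩ | ⟨rfl, rfl⟩ <;>
    simpa only [openSegment_symm ℝ] using h
  · exact fun h => ⟨a, b, c, d, rfl, rfl, h⟩

lemma not_segmentsMeet_of_shared {S : Finset Plane} (hS : GeneralPosition S) {p a b : S}
    (hpa : p ≠ a) (hpb : p ≠ b) (hab : a ≠ b) : ¬ SegmentsMeet s(p, a) s(p, b) := by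
  rw [segmentsMeet_mk, not_not, Set.disjoint_left]
  rintro z ⟨s, t, hs, ht, hst, rfl⟩ ⟨s', t', hs', ht', hst', h⟩
  refine hS p p.2 a a.2 b b.2 (fun h => hpa (Subtype.ext h)) (fun h => hpb (Subtype.ext h))
    (fun h => hab (Subtype.ext h)) ?_
  rw [collinear_iff_of_mem (p₀ := (p : Plane)) (by simp)]
  refine ⟨(a : Plane) - p, ?_⟩
  simp only [Set.mem_insert_iff, Set.mem_singleton_iff, forall_eq_or_imp, forall_eq, vadd_eq_add]
  refine ⟨⟨0, by simp⟩, ⟨1, by simp⟩, t / t', ?_⟩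
  obtain rfl : s = 1 - t := by linarith
  obtain rfl : s' = 1 - t' := by linarith
  have h2 : t' • (b : Plane) = t' • (p : Plane) + t • ((a : Plane) - p) := by
    have h3 : t' • (b : Plane) =
        ((1 - t') • (p : Plane) + t' • (b : Plane)) - (1 - t') • (p : Plane) := by module
    rw [h3, h]
    module
  have ht'' : t' ≠ 0 := ht'.ne'
  rw [div_eq_inv_mul, mul_smul, ← inv_smul_smul₀ ht'' (b : Plane), h2, smul_add,
    inv_smul_smul₀ ht'', add_comm]

/-- A generic shear of the plane gives the points of a finite set distinct abscissas. -/
lemma exists_injective_shear (S : Finset Plane) :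
    ∃ ε : ℝ, Function.Injective fun p : S => (p : Plane) 0 + ε * (p : Plane) 1 := by
  classical
  obtain ⟨ε, hε⟩ := Infinite.exists_notMem_finset ((S ×ˢ S).image fun q : Plane × Plane =>
    -(q.1 0 - q.2 0) / (q.1 1 - q.2 1))
  refine ⟨ε, fun p q hpq => ?_⟩
  simp only at hpq
  by_contra hne
  by_cases h1 : (p : Plane) 1 = (q : Plane) 1
  · rw [h1] at hpq
    refine hne (Subtype.ext ?_)
    ext i
    fin_cases i
    · simpa using hpq
    · simpa using h1
  · refine hε (Finset.mem_image.2 ⟨(p, q), by simp, ?_⟩)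
    have : (p : Plane) 1 - (q : Plane) 1 ≠ 0 := sub_ne_zero.2 h1
    simp only
    field_simp
    linarith

lemma eq_combination_of_shear {ε u : ℝ} {a b z : Plane}
    (hx : z 0 + ε * z 1 = (1 - u) * (a 0 + ε * a 1) + u * (b 0 + ε * b 1))
    (hy : z 1 = (1 - u) * a 1 + u * b 1) : z = (1 - u) • a + u • b := by
  ext i
  fin_cases i
  · simp only [Fin.zero_eta, PiLp.add_apply, PiLp.smul_apply, smul_eq_mul]
    linear_combination hx - ε * hy
  · simpa using hy

/-- In general position, non-crossing straight-edge graphs have at most three times as many edges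
as vertices. -/
lemma card_le_of_mem_conflictFree {S : Finset Plane} (hS : GeneralPosition S) {U : Finset S}
    {A : Finset (Sym2 S)} (hA : A ∈ conflictFree SegmentsMeet U) : A.card ≤ 3 * U.card := by
  classical
  obtain ⟨hAU, hAd, hAX⟩ := mem_conflictFree.1 hA
  obtain ⟨ε, hε⟩ := exists_injective_shear S
  set x : S → ℝ := fun p => (p : Plane) 0 + ε * (p : Plane) 1 with hx
  set y : S → ℝ := fun p => (p : Plane) 1 with hy
  set E : Finset (S × S) := (U ×ˢ U).filter fun e => x e.1 < x e.2 ∧ s(e.1, e.2) ∈ A with hE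
  have hEA : A.card ≤ E.card := by
    refine (Finset.card_le_card fun e he => ?_).trans
      (Finset.card_image_le (s := E) (f := fun e => s(e.1, e.2)))
    induction e with | _ a b =>
    have hab : x a ≠ x b := fun h => hAd _ he (by simpa using hε h)
    have ha := hAU _ he a (by simp)
    have hb := hAU _ he b (by simp)
    rcases lt_or_gt_of_ne hab with h | h
    · exact Finset.mem_image.2 ⟨(a, b), by simp [hE, ha, hb, h, he], rfl⟩
    · exact Finset.mem_image.2 ⟨(b, a), by simp [hE, ha, hb, h, Sym2.eq_swap (a := b), he],
        Sym2.eq_swap⟩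
  refine hEA.trans (IsPlaneEdgeSet.card_le (x := x) (y := y) ?_)
  have hmem : ∀ e ∈ E, e.1 ∈ U ∧ e.2 ∈ U ∧ x e.1 < x e.2 ∧ s(e.1, e.2) ∈ A := fun e he => by
    simpa only [hE, Finset.mem_filter, Finset.mem_product, and_assoc] using he
  refine ⟨hε, fun e he => (hmem e he).1, fun e he => (hmem e he).2.1,
    fun e he => (hmem e he).2.2.1, ?_, ?_⟩
  · intro e he w hw1 hw2 hw
    obtain ⟨-, -, hlt, heA⟩ := hmem e he
    have hd : x e.2 - x e.1 ≠ 0 := by linarith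
    refine hS e.1 e.1.2 e.2 e.2.2 w w.2 ?_ ?_ ?_ ?_
    · exact fun h => hlt.ne (congrArg x (Subtype.ext h))
    · exact fun h => hw1 (Subtype.ext h.symm)
    · exact fun h => hw2 (Subtype.ext h.symm)
    · set u := (x w - x e.1) / (x e.2 - x e.1) with hu
      have hu' : u * (x e.2 - x e.1) = x w - x e.1 := div_mul_cancel₀ _ hd
      have hz : (w : Plane) = (1 - u) • (e.1 : Plane) + u • (e.2 : Plane) := by
        refine eq_combination_of_shear (ε := ε) ?_ ?_
        · change x w = (1 - u) * x e.1 + u * x e.2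
          linarith
        · change y w = (1 - u) * y e.1 + u * y e.2
          rw [hw, lineHeight, hu]
          ring
      rw [collinear_iff_of_mem (p₀ := (e.1 : Plane)) (by simp)]
      refine ⟨(e.2 : Plane) - e.1, ?_⟩
      simp only [Set.mem_insert_iff, Set.mem_singleton_iff, forall_eq_or_imp, forall_eq,
        vadd_eq_add]
      refine ⟨⟨0, by simp⟩, ⟨1, by simp⟩, u, ?_⟩
      rw [hz]
      module
  · intro e he f hf hne t het hte hft htf heq
    obtain ⟨-, -, hel, heA⟩ := hmem e he
    obtain ⟨-, -, hfl, hfA⟩ := hmem f hf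
    have hne' : s(e.1, e.2) ≠ s(f.1, f.2) := by
      intro h
      rcases Sym2.eq_iff.1 h with ⟨h1, h2⟩ | ⟨h1, h2⟩
      · exact hne (Prod.ext h1 h2)
      · rw [h1, h2] at hel
        exact lt_asymm hel hfl
    refine hAX _ heA _ hfA hne' (segmentsMeet_mk.2 (Set.not_disjoint_iff.2 ?_))
    -- the point with sheared abscissa `t` at the common height
    have hseg : ∀ g : S × S, x g.1 < t → t < x g.2 →
        !₂[t - ε * lineHeight x y g t, lineHeight x y g t] ∈
          openSegment ℝ (g.1 : Plane) (g.2 : Plane) := by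
      intro g h1 h2
      have hd : 0 < x g.2 - x g.1 := by linarith
      set u := (t - x g.1) / (x g.2 - x g.1) with hu
      have hu' : u * (x g.2 - x g.1) = t - x g.1 := div_mul_cancel₀ _ hd.ne'
      refine ⟨1 - u, u, ?_, div_pos (by linarith) hd, by ring,
        (eq_combination_of_shear (ε := ε) ?_ ?_).symm⟩
      · rw [sub_pos, hu, div_lt_one hd]
        linarith
      · change _ = (1 - u) * x g.1 + u * x g.2
        simp
        linarith
      · change lineHeight x y g t = (1 - u) * y g.1 + u * y g.2
        rw [lineHeight, hu]
        ring
    refine ⟨_, hseg e het hte, ?_⟩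
    rw [heq]
    exact hseg f hft htf

lemma pgCount_le_card_conflictFree (S : Finset Plane) :
    pgCount S ≤ (conflictFree (V := S) SegmentsMeet Finset.univ).card := by
  classical
  rw [pgCount, ← Set.ncard_coe_finset]
  refine Set.ncard_le_ncard_of_injOn (fun G => G.edgeFinset) ?_ ?_ (Finset.finite_toSet _)
  · intro G hG
    rw [Finset.mem_coe, mem_conflictFree]
    refine ⟨fun _ _ a _ => Finset.mem_univ a, fun e he => G.not_isDiag_of_mem_edgeFinset he, ?_⟩
    intro e he f hf hne
    induction e with | _ a b =>
    induction f with | _ c d =>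
    rw [segmentsMeet_mk, not_not]
    exact hG a b c d (by simpa using he) (by simpa using hf) hne
  · intro G _ H _ h
    simpa using h

theorem pgCount_le_pow {S : Finset Plane} (hS : GeneralPosition S) :
    pgCount S ≤ 4096 ^ S.card := by
  classical
  have h := card_conflictFree_le (V := S) (X := SegmentsMeet) (fun _ _ h => h.symm)
    (fun p a b hpa hpb hab => not_segmentsMeet_of_shared hS hpa hpb hab)
    (fun U A hA => card_le_of_mem_conflictFree hS hA) Finset.univ
  rw [Finset.card_univ, Fintype.card_coe] at h
  exact (pgCount_le_card_conflictFree S).trans h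

end PointSets

theorem mainTheorem1 (N : ℕ) : pgMax N ≤ 4096 ^ N := by
  refine iSup_le fun S => iSup_le fun hN => iSup_le fun hS => ?_
  rw [← hN]
  exact_mod_cast pgCount_le_pow hS
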